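/- Let $\mathbb{H}$ be the division ring of real quaternions, let $n\ge 0$, and let $\mathbb{H}[x_1,\dots,x_n]$ be the ring of polynomials over $\mathbb{H}$ in $n$ central indeterminates (they commute with each other and with $\mathbb{H}$). A left ideal $P$ of a ring $R$ is called completely prime if $P\neq R$ and, for all $a,b\in R$ with $Pb\subseteq P$ and $ab\in P$, one has $a\in P$ or $b\in P$. The left radical of a left ideal $I$ of $R$ is the intersection of all completely prime left ideals of $R$ containing $I$. Let $I$ be a proper left ideal of $\mathbb{H}[x_1,\dots,x_n]$. Then the left radical of $I$ coincides with the set of all polynomials $F\in\mathbb{H}[x_1,\dots,x_n]$ such that for every $a\in\mathbb{H}$ there exists a natural number $N\ge 1$ satisfying $$(aF)^N\in I+I(aF)+I(aF)^2+\cdots+I(aF)^N,$$ where $Ig=\{hg : h\in I\}$ for a polynomial $g$. -/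

import Mathlib

/-- The ring `ℍ[x₁, …, xₙ]` of polynomials over the real quaternions in `n` central
indeterminates: the monoid algebra over `ℍ` of the additive monoid of exponents. (`MvPolynomial`
is available over commutative coefficients only.) -/
abbrev QuatPoly (n : ℕ) : Type := AddMonoidAlgebra (Quaternion ℝ) (Fin n →₀ ℕ)

/-- The constant polynomial `a`. -/
noncomputable def QuatPoly.const {n : ℕ} (a : Quaternion ℝ) : QuatPoly n :=
  AddMonoidAlgebra.single 0 a

/-- A left ideal `P` of a ring is completely prime if it is proper and, for all `a`, `b` with
`P b ⊆ P` and `a b ∈ P`, one has `a ∈ P` or `b ∈ P`. (`Ideal R` is the type of left ideals.) -/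
def IsCompletelyPrimeLeftIdeal {R : Type*} [Ring R] (P : Ideal R) : Prop :=
  P ≠ ⊤ ∧ ∀ a b : R, (∀ p ∈ P, p * b ∈ P) → a * b ∈ P → a ∈ P ∨ b ∈ P

/-- The left radical of a left ideal: the intersection of all completely prime left ideals
containing it. -/
def leftRadical {R : Type*} [Ring R] (I : Ideal R) : Ideal R :=
  sInf {P : Ideal R | IsCompletelyPrimeLeftIdeal P ∧ I ≤ P}

/-- The left ideal `I g = {h g | h ∈ I}`. -/
def leftIdealMulRight {R : Type*} [Ring R] (I : Ideal R) (g : R) : Ideal R :=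
  Submodule.map (LinearMap.toSpanSingleton R R g) I

theorem mem_leftIdealMulRight {R : Type*} [Ring R] (I : Ideal R) (g x : R) :
    x ∈ leftIdealMulRight I g ↔ ∃ h ∈ I, h * g = x :=
  Iff.rfl

/-! Call a proper left ideal pointlike if every polynomial is congruent to a constant modulo it.
Since ℍ is a division ring, pointlike ideals are completely prime. The Rabinowitsch trick and a
Nullstellensatz (`exists_sub_scalarExtension_mem`) show that if G fails the power condition for I,
some pointlike ideal contains I and misses G; G = aF gives one inclusion. Conversely, let P be
completely prime with F ∉ P. By `exists_scalar_mem_span_sup`, the left ideal generated by F and P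
contains a central c ∉ P. The trick applied to c gives a pointlike P' ⊇ P missing c, hence F.
Rescaling F to be 1 modulo P' contradicts the power condition. -/

namespace Quaternion

/-- The quaternion with the given components. -/
def ofComponents {R : Type*} [Zero R] [One R] [Neg R] (a b c d : R) : Quaternion R := ⟨a, b, c, d⟩

section

variable {R : Type*} [Zero R] [One R] [Neg R] (a b c d : R)

@[simp] theorem re_ofComponents : (ofComponents a b c d).re = a := rfl

@[simp] theorem imI_ofComponents : (ofComponents a b c d).imI = b := rfl

@[simp] theorem imJ_ofComponents : (ofComponents a b c d).imJ = c := rfl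

@[simp] theorem imK_ofComponents : (ofComponents a b c d).imK = d := rfl

end

/-- The map on quaternions induced by the structure map of an `ℝ`-algebra. -/noncomputable def scalarExtension (C : Type*) [CommRing C] [Algebra ℝ C] :
    Quaternion ℝ →+* Quaternion C where
  toFun h := ofComponents (algebraMap ℝ C h.re) (algebraMap ℝ C h.imI) (algebraMap ℝ C h.imJ)
    (algebraMap ℝ C h.imK)
  map_one' := by ext <;> simp
  map_zero' := by ext <;> simp
  map_add' x y := by ext <;> simp
  map_mul' x y := by ext <;> simp

/-! ### Left ideals of quaternions and their scalars. -/

section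

variable {C : Type*} [CommRing C]

/-- The scalars contained in a left ideal of quaternions. -/
def scalarIdeal (M : Ideal (Quaternion C)) : Ideal C :=
  Ideal.comap (algebraMap C (Quaternion C)) M

theorem mem_scalarIdeal {M : Ideal (Quaternion C)} {c : C} :
    c ∈ scalarIdeal M ↔ (c : Quaternion C) ∈ M := Iff.rfl

theorem mul_mem_of_mem_scalarIdeal {M : Ideal (Quaternion C)} {c : C} (hc : c ∈ scalarIdeal M)
    (b : Quaternion C) : (c : Quaternion C) * b ∈ M := by
  rw [coe_commutes]
  exact M.mul_mem_left _ hc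

theorem mem_of_components_mem {M : Ideal (Quaternion C)} {x : Quaternion C}
    (h0 : x.re ∈ scalarIdeal M) (h1 : x.imI ∈ scalarIdeal M)
    (h2 : x.imJ ∈ scalarIdeal M) (h3 : x.imK ∈ scalarIdeal M) : x ∈ M := by
  have : x = (x.re : Quaternion C) * 1 + (x.imI : Quaternion C) * (ofComponents 0 1 0 0) +
      (x.imJ : Quaternion C) * (ofComponents 0 0 1 0) + (x.imK : Quaternion C) * (ofComponents 0 0 0 1) := by
    ext <;> simp
  rw [this]
  exact add_mem (add_mem (add_mem (mul_mem_of_mem_scalarIdeal h0 _)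
    (mul_mem_of_mem_scalarIdeal h1 _)) (mul_mem_of_mem_scalarIdeal h2 _))
    (mul_mem_of_mem_scalarIdeal h3 _)

theorem exists_add_eq_one_of_notMem {R : Type*} [Ring R] {M : Ideal R} (hM : M.IsMaximal) {w : R}
    (hw : w ∉ M) : ∃ b, ∃ p ∈ M, b * w + p = 1 := by
  have h : Ideal.span {w} ⊔ M = ⊤ := by
    refine hM.1.2 _ (lt_of_le_of_ne le_sup_right fun h => hw ?_)
    rw [h]
    exact Ideal.mem_sup_left (Ideal.mem_span_singleton_self w)
  have h1 : (1 : R) ∈ Ideal.span {w} ⊔ M := h ▸ Submodule.mem_top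
  obtain ⟨y, hy, p, hp, e⟩ := Submodule.mem_sup.1 h1
  obtain ⟨b, rfl⟩ := Ideal.mem_span_singleton'.1 hy
  exact ⟨b, p, hp, e⟩

theorem scalarIdeal_isMaximal {M : Ideal (Quaternion C)} (hM : M.IsMaximal) :
    (scalarIdeal M).IsMaximal := by
  rw [Ideal.isMaximal_iff]
  refine ⟨fun h => hM.ne_top ((Ideal.eq_top_iff_one M).2 (by simpa [mem_scalarIdeal] using h)), ?_⟩
  intro J c hJ hc hcJ
  obtain ⟨b, p, hp, e⟩ := exists_add_eq_one_of_notMem hM hc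
  change b * (c : Quaternion C) + p = 1 at e
  set N : C := b.re * b.re + b.imI * b.imI + b.imJ * b.imJ + b.imK * b.imK with hN
  -- Both sides equal (1 - b̄c)(1 - bc), the norm of p.
  have key : ((1 - c * (2 * b.re - N * c) : C) : Quaternion C) = p - star b * c * p := by
    have hp' : p = 1 - b * c := by rw [← e]; abel
    rw [hp', hN]
    ext <;> simp <;> ring
  have h1 : 1 - c * (2 * b.re - N * c) ∈ J := by
    refine hJ (mem_scalarIdeal.2 ?_)
    rw [key]
    exact sub_mem hp (M.mul_mem_left _ hp)
  simpa using add_mem h1 (J.mul_mem_right (2 * b.re - N * c) hcJ)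

end

/-! ### Nullstellensatz for maximal left ideals. -/

section

variable {C : Type*} [CommRing C] [Algebra ℝ C]

@[simp] theorem re_scalarExtension (h : Quaternion ℝ) :
    (scalarExtension C h).re = algebraMap ℝ C h.re := rfl

@[simp] theorem imI_scalarExtension (h : Quaternion ℝ) :
    (scalarExtension C h).imI = algebraMap ℝ C h.imI := rfl

@[simp] theorem imJ_scalarExtension (h : Quaternion ℝ) :
    (scalarExtension C h).imJ = algebraMap ℝ C h.imJ := rfl

@[simp] theorem imK_scalarExtension (h : Quaternion ℝ) :
    (scalarExtension C h).imK = algebraMap ℝ C h.imK := rfl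

theorem coe_scalarExtension (r : ℝ) :
    scalarExtension C (r : Quaternion ℝ) = ((algebraMap ℝ C r : C) : Quaternion C) := by
  ext <;> simp 

/-- Zariski's lemma: the residue field is finite over ℝ, so it embeds in ℂ. -/
theorem exists_algHom_complex [Algebra.FiniteType ℝ C] (m : Ideal C) (hm : m.IsMaximal) :
    ∃ θ : C →ₐ[ℝ] ℂ, ∀ c, θ c = 0 ↔ c ∈ m := by
  let := Ideal.Quotient.field m
  have := finite_of_finite_type_of_isJacobsonRing ℝ (C ⧸ m)
  let σ : (C ⧸ m) →ₐ[ℝ] ℂ := IsAlgClosed.lift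
  refine ⟨σ.comp (Ideal.Quotient.mkₐ ℝ m), fun c => ?_⟩
  rw [← Ideal.Quotient.eq_zero_iff_mem]
  exact map_eq_zero σ

theorem exists_eigenvector [Algebra.FiniteType ℝ C] {M : Ideal (Quaternion C)}
    (hM : M.IsMaximal) : ∃ w ∉ M, ∀ c : C, ∃ d : Quaternion ℝ,
      (c : Quaternion C) * w - scalarExtension C d * w ∈ M := by
  obtain ⟨θ, hθ⟩ := exists_algHom_complex _ (scalarIdeal_isMaximal hM)
  have h1 : (1 : Quaternion C) ∉ M := fun h => hM.ne_top ((Ideal.eq_top_iff_one M).2 h)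
  by_cases hr : ∀ c, (θ c).im = 0
  · refine ⟨1, h1, fun c => ⟨((θ c).re : ℝ), ?_⟩⟩
    have : c - algebraMap ℝ C (θ c).re ∈ scalarIdeal M := by
      rw [← hθ, map_sub, AlgHom.commutes]
      apply Complex.ext <;> simp [hr c]
    rw [mem_scalarIdeal] at this
    rw [coe_scalarExtension, ← sub_mul, ← coe_sub, mul_one]
    exact this
  · push Not at hr
    obtain ⟨c₀, hc₀⟩ := hr
    let J : C := algebraMap ℝ C (θ c₀).im⁻¹ * (c₀ - algebraMap ℝ C (θ c₀).re)
    have hJ : θ J = Complex.I := by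
      simp only [J, map_mul, map_sub, AlgHom.commutes]
      apply Complex.ext <;> simp [hc₀]
    have main : ∃ w ∉ M, ∃ u : Quaternion ℝ,
        (J : Quaternion C) * w - scalarExtension C u * w ∈ M := by
      -- Modulo M, (J - i)(J + i) = J² + 1 vanishes: either J ≡ -i, or J + i is an eigenvector for
      -- i.
      by_cases hi : (J : Quaternion C) + (ofComponents 0 1 0 0) ∈ M
      · refine ⟨1, h1, (ofComponents 0 (-1) 0 0), ?_⟩
        convert hi using 1
        ext <;> simp 
      · refine ⟨_, hi, (ofComponents 0 1 0 0), ?_⟩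
        have : J * J + 1 ∈ scalarIdeal M := by
          rw [← hθ]; simp [hJ]
        rw [mem_scalarIdeal] at this
        convert this using 1
        ext <;> simp
    obtain ⟨w, hw, u, hu⟩ := main
    refine ⟨w, hw, fun c => ⟨((θ c).re : ℝ) + ((θ c).im : ℝ) * u, ?_⟩⟩
    have : c - (algebraMap ℝ C (θ c).re + algebraMap ℝ C (θ c).im * J) ∈ scalarIdeal M := by
      rw [← hθ]
      simp only [map_sub, map_add, map_mul, AlgHom.commutes, hJ]
      apply Complex.ext <;> simp
    have h2 := add_mem (mul_mem_of_mem_scalarIdeal this w)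
      (M.mul_mem_left (algebraMap ℝ C (θ c).im : C) hu)
    convert h2 using 1
    rw [map_add, map_mul, coe_scalarExtension, coe_scalarExtension, coe_sub, coe_add, coe_mul]
    noncomm_ring

theorem exists_sub_scalarExtension_mul_mem {M : Ideal (Quaternion C)} {w : Quaternion C}
    (hw : ∀ c : C, ∃ d : Quaternion ℝ, (c : Quaternion C) * w - scalarExtension C d * w ∈ M)
    (b : Quaternion C) : ∃ d : Quaternion ℝ, b * w - scalarExtension C d * w ∈ M := by
  obtain ⟨d0, h0⟩ := hw b.re
  obtain ⟨d1, h1⟩ := hw b.imI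
  obtain ⟨d2, h2⟩ := hw b.imJ
  obtain ⟨d3, h3⟩ := hw b.imK
  refine ⟨d0 + (ofComponents 0 1 0 0) * d1 + (ofComponents 0 0 1 0) * d2 + (ofComponents 0 0 0 1) * d3, ?_⟩
  have h := add_mem (add_mem (add_mem h0
    (M.mul_mem_left (scalarExtension C (ofComponents 0 1 0 0)) h1))
    (M.mul_mem_left (scalarExtension C (ofComponents 0 0 1 0)) h2))
    (M.mul_mem_left (scalarExtension C (ofComponents 0 0 0 1)) h3)
  have hb : b = b.re + scalarExtension C (ofComponents 0 1 0 0) * b.imI +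
      scalarExtension C (ofComponents 0 0 1 0) * b.imJ + scalarExtension C (ofComponents 0 0 0 1) * b.imK := by
    ext <;> simp 
  convert h using 1
  conv_lhs => rw [hb]
  simp only [map_add, map_mul]
  noncomm_ring

/-- Modulo a maximal left ideal, every quaternion over a real algebra of finite type is congruent
to a real quaternion. -/
theorem exists_sub_scalarExtension_mem [Algebra.FiniteType ℝ C] {M : Ideal (Quaternion C)}
    (hM : M.IsMaximal) (b : Quaternion C) : ∃ d : Quaternion ℝ, b - scalarExtension C d ∈ M := by
  obtain ⟨w, hw, hc⟩ := exists_eigenvector hM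
  obtain ⟨b₀, p, hp, e⟩ := exists_add_eq_one_of_notMem hM hw
  obtain ⟨d₀, h₀⟩ := exists_sub_scalarExtension_mul_mem hc b₀
  have h1 : 1 - scalarExtension C d₀ * w ∈ M := by
    convert add_mem h₀ hp using 1
    rw [← e]; abel
  have hd₀ : d₀ ≠ 0 := by
    rintro rfl
    simp only [map_zero, zero_mul, sub_zero] at h1
    exact hM.ne_top ((Ideal.eq_top_iff_one M).2 h1)
  -- Since d₀w ≡ 1, one gets b ≡ b d₀ w ≡ d w = (d d₀⁻¹) d₀ w ≡ d d₀⁻¹.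
  obtain ⟨d, hd⟩ := exists_sub_scalarExtension_mul_mem hc (b * scalarExtension C d₀)
  refine ⟨d * d₀⁻¹, ?_⟩
  have h2 := add_mem (sub_mem (M.mul_mem_left b h1) (M.mul_mem_left
    (scalarExtension C (d * d₀⁻¹)) h1)) hd
  have h3 : scalarExtension C d = scalarExtension C (d * d₀⁻¹) * scalarExtension C d₀ := by
    rw [← map_mul, mul_assoc, inv_mul_cancel₀ hd₀, mul_one]
  convert h2 using 1
  rw [h3]
  noncomm_ring

/-- A left ideal of quaternions that strictly contains a completely prime one contains a scalar
outside of it. -/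
theorem exists_scalar_mem_span_sup {P : Ideal (Quaternion C)}
    (hP : IsCompletelyPrimeLeftIdeal P) {F : Quaternion C} (hF : F ∉ P) :
    ∃ c : C, (c : Quaternion C) ∉ P ∧ (c : Quaternion C) ∈ Ideal.span {F} ⊔ P := by
  by_contra! hcon
  set Q := Ideal.span {F} ⊔ P with hQ
  have hQP : ∀ c : C, (c : Quaternion C) ∈ Q → (c : Quaternion C) ∈ P := fun c hc => by
    by_contra h
    exact hcon c h hc
  have hFQ : F ∈ Q := Ideal.mem_sup_left (Ideal.mem_span_singleton_self F)
  have htr : ∀ G ∈ Q, ∀ G' ∈ Q, (star G * G').re ∈ scalarIdeal P := by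
    intro G hG G' hG'
    have h : ((2 * (star G * G').re : C) : Quaternion C) ∈ P := by
      refine hQP _ ?_
      convert add_mem (Q.mul_mem_left (star G) hG') (Q.mul_mem_left (star G') hG) using 1
      ext <;> simp <;> ring
    have h2 := P.mul_mem_left (scalarExtension C ((1 / 2 : ℝ) : Quaternion ℝ)) h
    rw [coe_scalarExtension, ← coe_mul, ← mul_assoc] at h2
    have h3 : algebraMap ℝ C (1 / 2) * 2 = 1 := by
      rw [← map_ofNat (algebraMap ℝ C) 2, ← map_mul]; norm_num
    rwa [h3, one_mul] at h2
  -- The real part is cyclic, so `htr` controls every real part of G' Ḡ s; taking s = r, ri, rj, rk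
  -- recovers all components.
  have hstar : ∀ G ∈ Q, ∀ G' ∈ Q, ∀ r : Quaternion C, G' * star G * r ∈ P := by
    intro G hG G' hG' r
    have hre : ∀ s : Quaternion C, (G' * star G * s).re ∈ scalarIdeal P := by
      intro s
      have := htr G hG _ (Q.mul_mem_left s hG')
      convert this using 1
      simp; ring
    refine mem_of_components_mem (hre r) ?_ ?_ ?_
    · have := neg_mem (hre (r * (ofComponents 0 1 0 0)))
      convert this using 1
      simp; ring
    · have := neg_mem (hre (r * (ofComponents 0 0 1 0)))
      convert this using 1
      simp; ring
    · have := neg_mem (hre (r * (ofComponents 0 0 0 1)))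
      convert this using 1
      simp; ring
  have hbar : ∀ G ∈ Q, G ∉ P → star G ∈ P := by
    intro G hG hGP
    refine (hP.2 G (star G) (fun p hp => ?_) ?_).resolve_left hGP
    · simpa using hstar G hG p (Ideal.mem_sup_right hp) 1
    · simpa using hstar G hG G hG 1
  refine hF ?_
  have hbarF := hbar F hFQ hF
  -- The trace F + F̄ is a scalar of Q, so it lies in P, and F̄ ∈ P then forces F ∈ P.
  have h : ((2 * F.re : C) : Quaternion C) ∈ P := by
    refine hQP _ ?_
    convert add_mem hFQ (Ideal.mem_sup_right hbarF : star F ∈ Q) using 1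
    ext <;> simp; ring
  convert sub_mem h hbarF using 1
  ext <;> simp; ring

end

end Quaternion

open Polynomial

/-! ### Polynomial rings over ℍ as images of quaternion rings. -/

namespace Quaternion

/-- A ring containing compatible copies of a commutative real algebra `C`, as central elements, and
of the real quaternions receives a ring homomorphism from the quaternions over `C`. -/
theorem exists_ringHom_of_central {C B : Type*} [CommRing C] [Algebra ℝ C] [Ring B] (φ : C →+* B)
    (hφ : ∀ c b, φ c * b = b * φ c) (ι : Quaternion ℝ →+* B)
    (hι : ∀ r : ℝ, ι (r : Quaternion ℝ) = φ (algebraMap ℝ C r)) :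
    ∃ ψ : Quaternion C →+* B, (∀ c : C, ψ (c : Quaternion C) = φ c) ∧
      ∀ h, ψ (scalarExtension C h) = ι h := by
  let : Algebra C B := φ.toAlgebra' hφ
  let q : QuaternionAlgebra.Basis B (-1 : C) 0 (-1) :=
    { i := ι (ofComponents 0 1 0 0)
      j := ι (ofComponents 0 0 1 0)
      k := ι (ofComponents 0 0 0 1)
      i_mul_i := by
        rw [← map_mul, zero_smul, add_zero, neg_smul, one_smul, ← map_one ι, ← map_neg]
        congr 1; ext <;> simp
      j_mul_j := by
        rw [← map_mul, neg_smul, one_smul, ← map_one ι, ← map_neg]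
        congr 1; ext <;> simp
      i_mul_j := by
        rw [← map_mul]
        congr 1; ext <;> simp
      j_mul_i := by
        rw [← map_mul, zero_smul, zero_sub, ← map_neg]
        congr 1; ext <;> simp }
  have hq : ∀ x : Quaternion C, q.liftHom x = φ x.re + φ x.imI * ι (ofComponents 0 1 0 0) +
      φ x.imJ * ι (ofComponents 0 0 1 0) + φ x.imK * ι (ofComponents 0 0 0 1) := fun x => rfl
  refine ⟨(q.liftHom : Quaternion C →ₐ[C] B).toRingHom, fun c => ?_, fun h => ?_⟩
  · refine (hq _).trans ?_
    simp
  · refine (hq _).trans ?_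
    simp only [re_scalarExtension, imI_scalarExtension, imJ_scalarExtension, imK_scalarExtension,
      ← hι, ← map_mul, ← map_add]
    congr 1
    ext <;> simp

theorem exists_surjective_ringHom_quatPoly (n : ℕ) :
    ∃ ψ : Quaternion (AddMonoidAlgebra ℝ (Fin n →₀ ℕ)) →+* QuatPoly n, Function.Surjective ψ ∧
      ∀ h, ψ (scalarExtension _ h) = QuatPoly.const h := by
  let φ : AddMonoidAlgebra ℝ (Fin n →₀ ℕ) →+* QuatPoly n :=
    AddMonoidAlgebra.mapRingHom _ (algebraMap ℝ (Quaternion ℝ))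
  have hφ : ∀ c b, φ c * b = b * φ c := by
    intro c b
    induction c using AddMonoidAlgebra.induction_linear with
    | zero => simp
    | add f g hf hg => rw [map_add, add_mul, mul_add, hf, hg]
    | single m r =>
      induction b using AddMonoidAlgebra.induction_linear with
      | zero => simp
      | add f g hf hg => rw [add_mul, mul_add, hf, hg]
      | single k h =>
        simp only [φ, AddMonoidAlgebra.mapRingHom_single, AddMonoidAlgebra.single_mul_single]
        rw [add_comm, Algebra.commutes]
  obtain ⟨ψ, hψ, hψ'⟩ := exists_ringHom_of_central φ hφ
    (AddMonoidAlgebra.singleZeroRingHom : Quaternion ℝ →+* QuatPoly n)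
    (fun r => by
      change AddMonoidAlgebra.single _ _ = φ (AddMonoidAlgebra.single 0 r)
      simp only [φ, AddMonoidAlgebra.mapRingHom_single]
      rfl)
  refine ⟨ψ, ?_, fun h => hψ' h⟩
  intro b
  induction b using AddMonoidAlgebra.induction_linear with
  | zero => exact ⟨0, map_zero ψ⟩
  | add f g hf hg =>
    obtain ⟨x, rfl⟩ := hf
    obtain ⟨y, rfl⟩ := hg
    exact ⟨x + y, map_add ψ x y⟩
  | single m h =>
    refine ⟨((AddMonoidAlgebra.single m 1 : AddMonoidAlgebra ℝ (Fin n →₀ ℕ)) :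
      Quaternion (AddMonoidAlgebra ℝ (Fin n →₀ ℕ))) * scalarExtension _ h, ?_⟩
    rw [map_mul, hψ, hψ']
    simp [φ, AddMonoidAlgebra.singleZeroRingHom, AddMonoidAlgebra.single_mul_single]

/-- Adjoins the Rabinowitsch variable; `C[X]` stays of finite type when `C` is. -/
theorem exists_surjective_ringHom_polynomial {C R : Type*} [CommRing C] [Algebra ℝ C] [Ring R]
    {ψ : Quaternion C →+* R} (hψ : Function.Surjective ψ) :
    ∃ Ψ : Quaternion C[X] →+* R[X], Function.Surjective Ψ ∧
      ∀ h, Ψ (scalarExtension _ h) = Polynomial.C (ψ (scalarExtension C h)) := by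
  let φ : C[X] →+* R[X] := Polynomial.mapRingHom (ψ.comp (algebraMap C (Quaternion C)))
  have hcomm : ∀ (c : C) (r : R), ψ (c : Quaternion C) * r = r * ψ c := by
    intro c r
    obtain ⟨x, rfl⟩ := hψ r
    rw [← map_mul, coe_commutes, map_mul]
  have hφ : ∀ p q, φ p * q = q * φ p := by
    intro p q
    induction p using Polynomial.induction_on' with
    | add f g hf hg => rw [map_add, add_mul, mul_add, hf, hg]
    | monomial n c =>
      have h1 : φ (monomial n c) = Polynomial.C (ψ (c : Quaternion C)) * X ^ n := by
        simp [φ, C_mul_X_pow_eq_monomial]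
      have h2 : Polynomial.C (ψ (c : Quaternion C)) * q = q * Polynomial.C (ψ c) := by
        ext k
        rw [coeff_C_mul, coeff_mul_C, hcomm]
      rw [h1, mul_assoc, X_pow_mul, ← mul_assoc, h2, mul_assoc]
  obtain ⟨Ψ, hΨ, hΨ'⟩ := exists_ringHom_of_central φ hφ
    (Polynomial.C.comp (ψ.comp (scalarExtension C)))
    (fun r => by
      simp only [RingHom.comp_apply, coe_scalarExtension, φ]
      rw [IsScalarTower.algebraMap_apply ℝ C C[X], Polynomial.algebraMap_eq, coe_mapRingHom, map_C]
      rfl)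
  refine ⟨Ψ, ?_, fun h => hΨ' h⟩
  have hC : ∀ r : R, ∃ x, Ψ x = Polynomial.C r := by
    intro r
    obtain ⟨y, rfl⟩ := hψ r
    refine ⟨((Polynomial.C y.re : C[X]) : Quaternion C[X]) +
      ((Polynomial.C y.imI : C[X]) : Quaternion C[X]) * scalarExtension _ (ofComponents 0 1 0 0) +
      ((Polynomial.C y.imJ : C[X]) : Quaternion C[X]) * scalarExtension _ (ofComponents 0 0 1 0) +
      ((Polynomial.C y.imK : C[X]) : Quaternion C[X]) * scalarExtension _ (ofComponents 0 0 0 1), ?_⟩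
    simp only [map_add, map_mul, hΨ, hΨ']
    simp only [φ, coe_mapRingHom, map_C, RingHom.comp_apply, ← map_add, ← map_mul]
    congr 2
    change (y.re : Quaternion C) + (y.imI : Quaternion C) * _ + (y.imJ : Quaternion C) * _ +
      (y.imK : Quaternion C) * _ = y
    ext <;> simp
  intro b
  induction b using Polynomial.induction_on' with
  | add f g hf hg =>
    obtain ⟨x, rfl⟩ := hf
    obtain ⟨y, rfl⟩ := hg
    exact ⟨x + y, map_add Ψ x y⟩
  | monomial n r =>
    obtain ⟨x, hx⟩ := hC r
    refine ⟨x * ((X ^ n : C[X]) : Quaternion C[X]), ?_⟩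
    rw [map_mul, hΨ, hx]
    simp [φ, C_mul_X_pow_eq_monomial]

end Quaternion

/-! ### The Rabinowitsch trick. -/

section

variable {R : Type*} [Ring R]

/-- A combination `∑ fₘ Gᵐ`, `m ≤ k`, with coefficients in a left ideal `I`. -/
def IsPowerCombination (I : Ideal R) (G : R) (k : ℕ) (x : R) : Prop :=
  ∃ f : ℕ → R, (∀ m, f m ∈ I) ∧ x = ∑ m ∈ Finset.range (k + 1), f m * G ^ m

theorem IsPowerCombination.mul_add {I : Ideal R} {G x p : R} {k : ℕ}
    (h : IsPowerCombination I G k x) (hp : p ∈ I) :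
    IsPowerCombination I G (k + 1) (x * G + p) := by
  obtain ⟨f, hf, rfl⟩ := h
  refine ⟨fun m => Nat.casesOn m p f, fun m => ?_, ?_⟩
  · cases m with
    | zero => exact hp
    | succ m => exact hf m
  · rw [Finset.sum_range_succ' _ (k + 1), Finset.sum_mul]
    simp [pow_succ, mul_assoc]

theorem IsPowerCombination.mem_sum {I : Ideal R} {G x : R} {k : ℕ}
    (h : IsPowerCombination I G k x) :
    x ∈ ∑ m ∈ Finset.range (k + 1), leftIdealMulRight I (G ^ m) := by
  obtain ⟨f, hf, rfl⟩ := h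
  generalize k + 1 = n
  induction n with
  | zero => simp
  | succ n ih =>
    rw [Finset.sum_range_succ, Finset.sum_range_succ]
    exact Submodule.add_mem_sup ih ⟨f n, hf n, rfl⟩

theorem sum_leftIdealMulRight_le {I M : Ideal R} {G : R} (n : ℕ)
    (h : ∀ p ∈ I, ∀ m, p * G ^ m ∈ M) :
    ∑ m ∈ Finset.range n, leftIdealMulRight I (G ^ m) ≤ M := by
  induction n with
  | zero => simp
  | succ n ih =>
    rw [Finset.sum_range_succ]
    refine sup_le ih ?_
    rintro _ ⟨p, hp, rfl⟩
    exact h p hp n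

theorem coeff_mem_of_mem_map_C {I : Ideal R} {f : R[X]} (hf : f ∈ I.map (C : R →+* R[X])) (k : ℕ) :
    f.coeff k ∈ I := by
  induction hf using Submodule.span_induction generalizing k with
  | mem x hx =>
    obtain ⟨y, hy, rfl⟩ := hx
    rw [coeff_C]
    split_ifs
    · exact hy
    · exact I.zero_mem
  | zero => simp
  | add x y _ _ hx hy => simpa using add_mem (hx k) (hy k)
  | smul a x _ hx =>
    rw [smul_eq_mul, coeff_mul]
    exact sum_mem fun c _ => I.mul_mem_left _ (hx _)

/-- The Rabinowitsch trick for left ideals. -/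
theorem exists_pow_mem_sum_of_eq_top {I : Ideal R} {G : R}
    (h : I.map (C : R →+* R[X]) ⊔ Ideal.span {1 - X * C G} = ⊤) :
    ∃ N, 1 ≤ N ∧ G ^ N ∈ ∑ m ∈ Finset.range (N + 1), leftIdealMulRight I (G ^ m) := by
  have h1 : (1 : R[X]) ∈ I.map (C : R →+* R[X]) ⊔ Ideal.span {1 - X * C G} :=
    h ▸ Submodule.mem_top
  obtain ⟨p, hp, y, hy, e⟩ := Submodule.mem_sup.1 h1
  obtain ⟨q, rfl⟩ := Ideal.mem_span_singleton'.1 hy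
  have hq : q = 1 - p + q * C G * X := by
    rw [← e, mul_sub, mul_one, X_mul, mul_assoc]; abel
  -- Coefficientwise, q₀ = 1 - p₀ and qₖ₊₁ = qₖG - pₖ₊₁, with all pₖ in I.
  have key : ∀ k, IsPowerCombination I G k (G ^ k - q.coeff k) := by
    intro k
    induction k with
    | zero =>
      refine ⟨fun _ => p.coeff 0, fun _ => coeff_mem_of_mem_map_C hp 0, ?_⟩
      have := congrArg (fun f => coeff f 0) hq
      simp only [coeff_add, coeff_sub, coeff_one_zero, coeff_mul_X_zero, add_zero] at this
      simp [this]
    | succ k ih =>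
      have := congrArg (fun f => coeff f (k + 1)) hq
      simp only [coeff_add, coeff_sub, coeff_mul_X, coeff_mul_C] at this
      convert ih.mul_add (coeff_mem_of_mem_map_C hp (k + 1)) using 1
      rw [this, coeff_one, if_neg (Nat.succ_ne_zero k), pow_succ]
      noncomm_ring
  -- Just beyond the degree the coefficient of q vanishes, and the exponent is at least 1.
  refine ⟨q.natDegree + 1, Nat.le_add_left _ _, ?_⟩
  have := (key (q.natDegree + 1)).mem_sum
  rwa [coeff_eq_zero_of_natDegree_lt (Nat.lt_succ_self _), sub_zero] at this

end

/-! ### Completely prime and pointlike left ideals. -/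

/-- A proper left ideal containing a translate of every polynomial by a constant is completely
prime. -/
theorem isCompletelyPrime_of_exists_sub_const_mem {n : ℕ} {P : Ideal (QuatPoly n)} (hP : P ≠ ⊤)
    (h : ∀ b, ∃ d : Quaternion ℝ, b - QuatPoly.const d ∈ P) : IsCompletelyPrimeLeftIdeal P := by
  refine ⟨hP, fun a b hb hab => or_iff_not_imp_right.2 fun hbP => ?_⟩
  obtain ⟨d, hd⟩ := h a
  have h1 : QuatPoly.const d * b ∈ P := by
    convert sub_mem hab (hb _ hd) using 1
    noncomm_ring
  by_cases hd0 : d = 0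
  · simpa [hd0, QuatPoly.const] using hd
  · refine absurd ?_ hbP
    convert P.mul_mem_left (QuatPoly.const d⁻¹) h1 using 1
    rw [← mul_assoc]
    simp only [QuatPoly.const, AddMonoidAlgebra.single_mul_single, inv_mul_cancel₀ hd0, add_zero]
    exact (one_mul b).symm

theorem exists_le_notMem_of_pow_notMem {n : ℕ} {I : Ideal (QuatPoly n)} {G : QuatPoly n}
    (h : ¬ ∃ N, 1 ≤ N ∧ G ^ N ∈ ∑ m ∈ Finset.range (N + 1), leftIdealMulRight I (G ^ m)) :
    ∃ P : Ideal (QuatPoly n), I ≤ P ∧ G ∉ P ∧ P ≠ ⊤ ∧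
      ∀ b, ∃ d : Quaternion ℝ, b - QuatPoly.const d ∈ P := by
  obtain ⟨M, hM, hJM⟩ := Ideal.exists_le_maximal _ (mt exists_pow_mem_sum_of_eq_top h)
  obtain ⟨ψ, hψ, hψ'⟩ := Quaternion.exists_surjective_ringHom_quatPoly n
  obtain ⟨Ψ, hΨ, hΨ'⟩ := Quaternion.exists_surjective_ringHom_polynomial hψ
  have h1 : (1 : (QuatPoly n)[X]) ∉ M := fun h => hM.ne_top ((Ideal.eq_top_iff_one M).2 h)
  refine ⟨M.comap C, ?_, ?_, ?_, fun b => ?_⟩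
  · exact fun x hx => hJM (Ideal.mem_sup_left (Ideal.mem_map_of_mem C hx))
  · intro hG
    refine h1 ?_
    have h2 : 1 - X * C G ∈ M :=
      hJM (Ideal.mem_sup_right (Ideal.mem_span_singleton_self _))
    simpa using add_mem h2 (M.mul_mem_left X hG)
  · intro ht
    refine h1 ?_
    have : (1 : QuatPoly n) ∈ M.comap C := ht ▸ Submodule.mem_top
    simpa using this
  · obtain ⟨x, hx⟩ := hΨ (C b)
    -- Pulling M back to quaternions over a finite type algebra makes the Nullstellensatz available.
    have := Ideal.comap_isMaximal_of_surjective Ψ hΨ (K := M)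
    obtain ⟨d, hd⟩ := Quaternion.exists_sub_scalarExtension_mem this x
    refine ⟨d, ?_⟩
    rw [Ideal.mem_comap, map_sub, hx, hΨ', hψ', ← map_sub] at hd
    exact hd

theorem IsCompletelyPrimeLeftIdeal.comap {A B : Type*} [Ring A] [Ring B] {f : A →+* B}
    (hf : Function.Surjective f) {P : Ideal B} (hP : IsCompletelyPrimeLeftIdeal P) :
    IsCompletelyPrimeLeftIdeal (P.comap f) := by
  refine ⟨Ideal.comap_ne_top f hP.1, fun a b hb hab => ?_⟩
  refine hP.2 (f a) (f b) (fun p hp => ?_) (by simpa using hab)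
  obtain ⟨x, rfl⟩ := hf p
  simpa using hb x hp

theorem exists_central_mem_span_sup {n : ℕ} {P : Ideal (QuatPoly n)}
    (hP : IsCompletelyPrimeLeftIdeal P) {F : QuatPoly n} (hF : F ∉ P) :
    ∃ c, (∀ b, c * b = b * c) ∧ c ∉ P ∧ c ∈ Ideal.span {F} ⊔ P := by
  obtain ⟨ψ, hψ, -⟩ := Quaternion.exists_surjective_ringHom_quatPoly n
  obtain ⟨F, rfl⟩ := hψ F
  obtain ⟨c, hc, hc'⟩ := Quaternion.exists_scalar_mem_span_sup (hP.comap hψ) (F := F) hF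
  refine ⟨ψ c, fun b => ?_, hc, ?_⟩
  · obtain ⟨x, rfl⟩ := hψ b
    rw [← map_mul, Quaternion.coe_commutes, map_mul]
  · obtain ⟨y, hy, p, hp, e⟩ := Submodule.mem_sup.1 hc'
    obtain ⟨r, rfl⟩ := Ideal.mem_span_singleton'.1 hy
    rw [← e, map_add, map_mul]
    exact add_mem (Ideal.mul_mem_left _ _ (Ideal.mem_sup_left (Ideal.mem_span_singleton_self _)))
      (Ideal.mem_sup_right hp)

theorem IsCompletelyPrimeLeftIdeal.pow_notMem_of_central {R : Type*} [Ring R] {P : Ideal R}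
    (hP : IsCompletelyPrimeLeftIdeal P) {c : R} (hc : ∀ b, c * b = b * c) (hcP : c ∉ P) (N : ℕ) :
    c ^ N ∉ P := by
  induction N with
  | zero =>
    rw [pow_zero]
    exact fun h => hP.1 ((Ideal.eq_top_iff_one P).2 h)
  | succ N ih =>
    intro h
    rw [pow_succ] at h
    rcases hP.2 _ _ (fun p hp => by rw [← hc]; exact P.mul_mem_left c hp) h with h | h
    exacts [ih h, hcP h]

/-- A completely prime left ideal is an intersection of left ideals modulo which every polynomial
is congruent to a constant. -/
theorem IsCompletelyPrimeLeftIdeal.exists_le_notMem {n : ℕ} {P : Ideal (QuatPoly n)}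
    (hP : IsCompletelyPrimeLeftIdeal P) {F : QuatPoly n} (hF : F ∉ P) :
    ∃ P' : Ideal (QuatPoly n), P ≤ P' ∧ F ∉ P' ∧ P' ≠ ⊤ ∧
      ∀ b, ∃ d : Quaternion ℝ, b - QuatPoly.const d ∈ P' := by
  obtain ⟨c, hc, hcP, hcF⟩ := exists_central_mem_span_sup hP hF
  have hpow : ∀ m b, b * c ^ m = c ^ m * b := fun m b =>
    ((show Commute c b from hc b).pow_left m).eq.symm
  obtain ⟨P', hPP', hcP', ht, h⟩ := exists_le_notMem_of_pow_notMem (I := P) (G := c) (by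
    rintro ⟨N, -, hN⟩
    refine hP.pow_notMem_of_central hc hcP N (sum_leftIdealMulRight_le _ (fun p hp m => ?_) hN)
    rw [hpow]
    exact P.mul_mem_left _ hp)
  refine ⟨P', hPP', fun hFP' => hcP' ?_, ht, h⟩
  exact sup_le ((Ideal.span_singleton_le_iff_mem P').2 hFP') hPP' hcF

theorem mainTheorem3 (n : ℕ) (I : Ideal (QuatPoly n)) (hI : I ≠ ⊤) :
    (leftRadical I : Set (QuatPoly n)) =
      {F : QuatPoly n | ∀ a : Quaternion ℝ, ∃ N : ℕ, 1 ≤ N ∧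
        (QuatPoly.const a * F) ^ N ∈
          ∑ m ∈ Finset.range (N + 1), leftIdealMulRight I ((QuatPoly.const a * F) ^ m)} := by
  ext F
  rw [SetLike.mem_coe, Set.mem_ofPred_eq]
  constructor
  · intro hF a
    by_contra hcon
    obtain ⟨P, hIP, hG, ht, h⟩ := exists_le_notMem_of_pow_notMem hcon
    exact hG (P.mul_mem_left _
      (Submodule.mem_sInf.1 hF P ⟨isCompletelyPrime_of_exists_sub_const_mem ht h, hIP⟩))
  · intro hF
    refine Submodule.mem_sInf.2 fun P ⟨hP, hIP⟩ => ?_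
    by_contra hFP
    obtain ⟨P', hPP', hFP', ht, h⟩ := hP.exists_le_notMem hFP
    obtain ⟨d, hd⟩ := h F
    have hd0 : d ≠ 0 := by
      rintro rfl
      exact hFP' (by simpa [QuatPoly.const] using hd)
    -- As F ≡ d modulo P', this choice of a makes G ≡ 1. Then pGᵐ = p(Gᵐ - 1) + p stays in P' for p
    -- ∈ I, although P' need not be stable under right multiplication.
    obtain ⟨N, -, hN⟩ := hF d⁻¹
    set G := QuatPoly.const d⁻¹ * F with hG
    have h1 : G - 1 ∈ P' := by
      convert P'.mul_mem_left (QuatPoly.const d⁻¹) hd using 1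
      rw [mul_sub, hG]
      simp only [QuatPoly.const, AddMonoidAlgebra.single_mul_single, inv_mul_cancel₀ hd0, add_zero]
      rfl
    have h2 : ∀ m, G ^ m - 1 ∈ P' := fun m => by
      rw [← geom_sum_mul]
      exact P'.mul_mem_left _ h1
    have h3 : G ^ N ∈ P' := sum_leftIdealMulRight_le _ (fun p hp m => by
      simpa [mul_sub] using add_mem (P'.mul_mem_left p (h2 m)) (hPP' (hIP hp))) hN
    exact ht ((Ideal.eq_top_iff_one P').2 (by simpa using sub_mem h3 (h2 N)))
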